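/- Consider a parking lot with power capacity and a finite number of parking spaces, each with a charger. EVs arrive in a Poisson stream; each EV that finds a free space stays for its parking time, which is exponential of rate $\mu>0$, and an EV that finds no free space is lost. Each EV needs a charging time (at full power) that is exponential of rate $\nu>0$; interarrival, parking and charging times are mutually independent. When there are $U$ uncharged EVs and the power capacity is $m$, the total power $\min\{U,m\}$ is shared equally among them. Let $U(t)$ be the number of uncharged EVs and $Q(t)$ the total number of EVs, so that $(U(t),Q(t))$ is a Markov process on $\{(u,q): 0\le u\le q\le k\}$, $k$ being the number of spaces, with transition rates $$(u,q)\to(u+1,q+1):\ \text{arrival rate, if } q<k;\qquad (u,q)\to(u-1,q):\ \nu\min\{u,m\};$$ $$(u,q)\to(u-1,q-1):\ \mu u;\qquad (u,q)\to(u,q-1):\ \mu(q-u).$$ Let $\lambda,\mu,\nu>0$ and $0<M\le K$ be real numbers. For $n\in\mathbb N$ let the $n$-th system have arrival rate $n\lambda$, power capacity $nM$ and $\lfloor nK\rfloor$ parking spaces (that is, $nK$ spaces when this is an integer), with $\mu$ and $\nu$ fixed. Let $E_\mu$ and $E_\nu$ be independent exponential random variables with rates $\mu$ and $\nu$. Then: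 1. for every $n$, the process of the $n$-th system has exactly one stationary distribution; let $(U_n(\infty),Q_n(\infty))$ be a random vector with this distribution; 2. for every $u>0$ the random variable $\min\{E_\mu,E_\nu\max\{1,u/M\}\}$ is integrable, and the equation $$u^*=\min\{\lambda,\mu K\}\,\mathbb E\Big[\min\Big\{E_\mu,\;E_\nu\max\Big\{1,\frac{u^*}{M}\Big\}\Big\}\Big]$$ has exactly one positive solution $u^*$; 3. $U_n(\infty)/n\to u^*$ in probability as $n\to\infty$, that is, for every $\varepsilon>0$, $\mathbb P\big(|U_n(\infty)/n-u^*|\ge\varepsilon\big)\to0$ (equivalently, $U_n(\infty)/n$ converges in distribution to the constant $u^*$). -/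

import Mathlib

open MeasureTheory ProbabilityTheory Filter Topology
open scoped Matrix

noncomputable section

/-- The data of a parking lot: arrival rate, rate of the exponential parking times, rate of the
exponential charging times, power capacity and number of parking spaces. -/
structure ParkingLot where
  arrivalRate : ℝ
  parkingRate : ℝ
  chargingRate : ℝ
  power : ℝ
  spaces : ℕ

namespace ParkingLot

/-- The states `(u, q)` with `0 ≤ u ≤ q ≤ spaces`: `u` is the number of uncharged EVs and `q` the
total number of EVs. -/
abbrev State (S : ParkingLot) : Type :=
  {s : Fin (S.spaces + 1) × Fin (S.spaces + 1) // s.1 ≤ s.2}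

variable {S : ParkingLot}

/-- The number of uncharged EVs. -/
def State.uncharged (s : S.State) : ℕ := s.1.1

/-- The total number of EVs. -/
def State.total (s : S.State) : ℕ := s.1.2

/-- The power consumed when there are `u` uncharged EVs. -/
def powerUsed (S : ParkingLot) (u : ℕ) : ℝ := min (u : ℝ) S.power

/-- The transition rate from the state `s` to a different state `t`. The four cases are: an
arrival that finds a free space (in a full lot there is no target state, the EV is lost); the
completion of a charge (the consumed power is shared equally by the uncharged EVs, and a charging
time at full power is exponential); the departure of an uncharged EV; the departure of a fully
charged EV. -/
def rate (S : ParkingLot) (s t : S.State) : ℝ :=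
  if t.uncharged = s.uncharged + 1 ∧ t.total = s.total + 1 then
    S.arrivalRate
  else if t.uncharged + 1 = s.uncharged ∧ t.total = s.total then
    S.chargingRate * S.powerUsed s.uncharged
  else if t.uncharged + 1 = s.uncharged ∧ t.total + 1 = s.total then
    S.parkingRate * s.uncharged
  else if t.uncharged = s.uncharged ∧ t.total + 1 = s.total then
    S.parkingRate * ((s.total : ℝ) - s.uncharged)
  else 0

/-- The generator of the Markov process `(U(t), Q(t))`. -/
def generator (S : ParkingLot) : Matrix S.State S.State ℝ :=
  Matrix.of fun s t => if s = t then -∑ r, S.rate s r else S.rate s t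

/-- The transition probabilities of `(U(t), Q(t))` over a time `t`. -/
def transition (S : ParkingLot) (t : ℝ) : Matrix S.State S.State ℝ :=
  NormedSpace.exp (t • S.generator)

/-- `π` is a stationary distribution of the Markov process `(U(t), Q(t))`. -/
def IsStationary (S : ParkingLot) (π : Measure S.State) : Prop :=
  IsProbabilityMeasure π ∧
    ∀ t : ℝ, 0 ≤ t → (fun s => π.real {s}) ᵥ* S.transition t = fun s => π.real {s}

/-- The `n`-th system: arrival rate `n * lam`, power capacity `n * M`, and `⌊n * K⌋` parking
spaces, that is, `n * K` spaces whenever this is an integer. -/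
def scaled (lam mu nu M K : ℝ) (n : ℕ) : ParkingLot where
  arrivalRate := n * lam
  parkingRate := mu
  chargingRate := nu
  power := n * M
  spaces := ⌊(n : ℝ) * K⌋₊

end ParkingLot

end

/-! Since `min E_μ (c E_ν)` has mean `1 / (μ + ν / c)`, the fixed-point equation is the drift
balance `μ u + ν min(u, M) = min(λ, μ K)`. Its left side is strictly increasing in `u`, which gives
the unique root `v` (`eq_mul_inv_iff_drift_balance`, `exists_drift_balance`,
`drift_balance_injective`). Concentration needs no fluid limit: under a stationary law the generator
applied to any function has mean zero. Put `b = min(λ/μ, K)`, `x = q - n b` and `y = (q - u) - n (b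
- v)`, so that `u - n v = x - y`. The total `q` is an autonomous loss system pulled towards `n b`.
The charged count `q - u` is pulled towards `n (b - v)` up to an error controlled by `x`. A weighted
sum `β x² + y²` therefore has drift at most `-(μ/2)(u - n v)² + C n`, so the stationary mean of `(u
- n v)²` is `O(n)` (`exists_second_moment_bound`), and Chebyshev's inequality concludes. Existence
and uniqueness of the stationary law hold because every state of the finite chain leads to the empty
lot (`existsUnique_stationary_vector`). -/

/-! ### Stationary vectors of finite generators. -/

section Generator

variable {ι : Type*} [Fintype ι] {G : Matrix ι ι ℝ}

/-- Multiplying column `j` by the sign of `v j` keeps the diagonal term exact and can only increase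
the others, so `|v| G ≥ 0`; the coordinates of `|v| G` sum to zero because the rows of `G` do. -/
theorem vecMul_abs_eq_zero (hoff : ∀ i j, i ≠ j → 0 ≤ G i j) (hrow : ∀ i, ∑ j, G i j = 0)
    {v : ι → ℝ} (hv : v ᵥ* G = 0) : |v| ᵥ* G = 0 := by
  have hnonneg : ∀ j, 0 ≤ ∑ i, |v i| * G i j := by
    intro j
    have hj : ∑ i, v i * G i j = 0 := congrFun hv j
    obtain ⟨s, hs, hsj⟩ : ∃ s : ℝ, |s| ≤ 1 ∧ s * v j = |v j| := by
      rcases le_total 0 (v j) with h | h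
      · exact ⟨1, by simp, by simp [abs_of_nonneg h]⟩
      · exact ⟨-1, by simp, by simp [abs_of_nonpos h]⟩
    calc 0 = ∑ i, s * v i * G i j := by simp [mul_assoc, ← Finset.mul_sum, hj]
      _ ≤ ∑ i, |v i| * G i j := by
        refine Finset.sum_le_sum fun i _ => ?_
        rcases eq_or_ne i j with rfl | hij
        · rw [hsj]
        · refine mul_le_mul_of_nonneg_right ?_ (hoff i j hij)
          calc s * v i ≤ |s| * |v i| := (le_abs_self _).trans (abs_mul _ _).le
            _ ≤ |v i| := mul_le_of_le_one_left (abs_nonneg _) hs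
  have hsum : ∑ j, ∑ i, |v i| * G i j = 0 := by
    rw [Finset.sum_comm]
    simp [← Finset.mul_sum, hrow]
  funext j
  exact (Finset.sum_eq_zero_iff_of_nonneg fun j _ => hnonneg j).1 hsum j (Finset.mem_univ j)

/-- Zeros propagate backwards along transitions: if `w j = 0`, the balance at `j` is a vanishing sum
of nonnegative terms. The rank `r` ensures that `i₀` is reached from everywhere. -/
theorem eq_zero_of_vecMul_eq_zero (hoff : ∀ i j, i ≠ j → 0 ≤ G i j) {i₀ : ι} (r : ι → ℕ)
    (hr : ∀ i, i ≠ i₀ → ∃ j, r j < r i ∧ 0 < G i j) {w : ι → ℝ} (hw : ∀ i, 0 ≤ w i)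
    (hwG : w ᵥ* G = 0) (hw₀ : w i₀ = 0) : w = 0 := by
  have key : ∀ n, ∀ i, r i = n → w i = 0 := by
    intro n
    induction n using Nat.strong_induction_on with
    | _ n ih =>
      rintro i rfl
      rcases eq_or_ne i i₀ with rfl | hi
      · exact hw₀
      obtain ⟨j, hj, hij⟩ := hr i hi
      have hwj : w j = 0 := ih _ hj j rfl
      have hsum : ∑ k, w k * G k j = 0 := congrFun hwG j
      have hz := (Finset.sum_eq_zero_iff_of_nonneg (fun k _ => by
        rcases eq_or_ne k j with rfl | hkj
        · simp [hwj]
        · exact mul_nonneg (hw k) (hoff k j hkj))).1 hsum i (Finset.mem_univ i)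
      exact (mul_eq_zero.1 hz).resolve_right hij.ne'
  funext i
  exact key _ i rfl

variable [DecidableEq ι]

theorem existsUnique_stationary_vector (hoff : ∀ i j, i ≠ j → 0 ≤ G i j)
    (hrow : ∀ i, ∑ j, G i j = 0) (i₀ : ι) (r : ι → ℕ)
    (hr : ∀ i, i ≠ i₀ → ∃ j, r j < r i ∧ 0 < G i j) :
    ∃! p : ι → ℝ, (∀ i, 0 ≤ p i) ∧ ∑ i, p i = 1 ∧ p ᵥ* G = 0 := by
  have hdet : G.det = 0 := Matrix.exists_mulVec_eq_zero_iff.1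
    ⟨1, fun h => one_ne_zero (congrFun h i₀), by
      funext i; simpa [Matrix.mulVec, dotProduct] using hrow i⟩
  obtain ⟨v, hv0, hv⟩ := Matrix.exists_vecMul_eq_zero_iff.2 hdet
  have hpos : 0 < ∑ i, |v i| := by
    refine lt_of_le_of_ne (Finset.sum_nonneg fun i _ => abs_nonneg _) fun h => hv0 ?_
    funext i
    exact abs_eq_zero.1 ((Finset.sum_eq_zero_iff_of_nonneg fun i _ => abs_nonneg (v i)).1 h.symm i
      (Finset.mem_univ i))
  refine ⟨(∑ i, |v i|)⁻¹ • |v|, ⟨fun i => ?_, ?_, ?_⟩, ?_⟩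
  · exact mul_nonneg (inv_nonneg.2 hpos.le) (abs_nonneg _)
  · simp only [Pi.smul_apply, Pi.abs_apply, smul_eq_mul, ← Finset.mul_sum]
    exact inv_mul_cancel₀ hpos.ne'
  · rw [Matrix.smul_vecMul, vecMul_abs_eq_zero hoff hrow hv, smul_zero]
  suffices huniq : ∀ p p' : ι → ℝ, ∑ i, p i = 1 → ∑ i, p' i = 1 → p ᵥ* G = 0 → p' ᵥ* G = 0 →
      p i₀ ≤ p' i₀ → p = p' by
    have hq : ∑ i, ((∑ i, |v i|)⁻¹ • |v|) i = 1 := by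
      simp only [Pi.smul_apply, Pi.abs_apply, smul_eq_mul, ← Finset.mul_sum]
      exact inv_mul_cancel₀ hpos.ne'
    have hqG : ((∑ i, |v i|)⁻¹ • |v|) ᵥ* G = 0 := by
      rw [Matrix.smul_vecMul, vecMul_abs_eq_zero hoff hrow hv, smul_zero]
    rintro p ⟨-, hp, hpG⟩
    rcases le_total (p i₀) (((∑ i, |v i|)⁻¹ • |v|) i₀) with h | h
    · exact huniq _ _ hp hq hpG hqG h
    · exact (huniq _ _ hq hp hqG hpG h).symm
  intro p p' hp hp' hpG hp'G h
  have hd : (p - p') ᵥ* G = 0 := by rw [Matrix.sub_vecMul, hpG, hp'G, sub_zero]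
  -- Twice the positive part of `p - p'` is invariant and vanishes at `i₀`, hence everywhere; so `p
  -- ≤ p'`, and equal total mass forces equality.
  have hz : |p - p'| + (p - p') = 0 := by
    refine eq_zero_of_vecMul_eq_zero hoff r hr (i₀ := i₀) (fun i => ?_) ?_ ?_
    · have := neg_abs_le (p i - p' i)
      simp only [Pi.add_apply, Pi.abs_apply, Pi.sub_apply]
      linarith
    · rw [Matrix.add_vecMul, vecMul_abs_eq_zero hoff hrow hd, hd, add_zero]
    · simp only [Pi.add_apply, Pi.abs_apply, Pi.sub_apply]
      rw [abs_of_nonpos (by linarith)]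
      ring
  have hle : ∀ i ∈ Finset.univ, p i ≤ p' i := by
    intro i _
    have := congrFun hz i
    simp only [Pi.add_apply, Pi.abs_apply, Pi.sub_apply, Pi.zero_apply] at this
    have := abs_nonneg (p i - p' i)
    linarith
  funext i
  exact (Finset.sum_eq_sum_iff_of_le hle).1 (hp.trans hp'.symm) i (Finset.mem_univ i)

attribute [local instance] Matrix.linftyOpNormedRing Matrix.linftyOpNormedAlgebra in
theorem vecMul_exp_eq_self_iff (p : ι → ℝ) :
    (∀ t : ℝ, 0 ≤ t → p ᵥ* NormedSpace.exp (t • G) = p) ↔ p ᵥ* G = 0 := by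
  have hderiv : ∀ t : ℝ, HasDerivAt (fun t : ℝ => p ᵥ* NormedSpace.exp (t • G))
      ((p ᵥ* G) ᵥ* NormedSpace.exp (t • G)) t := by
    intro t
    let φ : Matrix ι ι ℝ →ₗ[ℝ] (ι → ℝ) :=
      { toFun := fun A => p ᵥ* A
        map_add' := fun A B => Matrix.vecMul_add _ _ _
        map_smul' := fun c A => Matrix.vecMul_smul _ _ _ }
    have h := (LinearMap.toContinuousLinearMap φ).hasFDerivAt.comp_hasDerivAt t
      (hasDerivAt_exp_smul_const' G t)
    rw [Matrix.vecMul_vecMul]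
    exact h
  constructor
  · intro h
    have h0 := (hderiv 0).hasDerivWithinAt (s := Set.Ici 0)
    have h1 : HasDerivWithinAt (fun t : ℝ => p ᵥ* NormedSpace.exp (t • G)) 0 (Set.Ici 0) 0 :=
      (hasDerivWithinAt_const (0 : ℝ) (Set.Ici 0) p).congr (fun t ht => h t ht) (h 0 le_rfl)
    have h2 := (uniqueDiffWithinAt_Ici (0 : ℝ)).eq_deriv _ h0 h1
    simpa using h2
  · intro h t _
    have := is_const_of_deriv_eq_zero (fun t => (hderiv t).differentiableAt)
      (fun t => by rw [(hderiv t).deriv, h, Matrix.zero_vecMul]) t 0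
    simpa using this

end Generator

/-! ### The mean of a minimum of scaled exponentials. -/

section Exponential

theorem expMeasure_Ioi {r t : ℝ} (hr : 0 < r) (ht : 0 ≤ t) :
    expMeasure r (Set.Ioi t) = ENNReal.ofReal (Real.exp (-(r * t))) := by
  have := isProbabilityMeasure_expMeasure hr
  rw [← Set.compl_Iic, prob_compl_eq_one_sub measurableSet_Iic, ← ofReal_cdf,
    cdf_expMeasure_eq hr, if_pos ht, ← ENNReal.ofReal_one, ← ENNReal.ofReal_sub]
  · simp
  · have : Real.exp (-(r * t)) ≤ 1 := Real.exp_le_one_iff.2 (by nlinarith)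
    linarith

theorem ae_pos_of_hasLaw_expMeasure {Ω : Type*} [MeasurableSpace Ω] {P : Measure Ω}
    [IsProbabilityMeasure P] {X : Ω → ℝ} {r : ℝ} (hr : 0 < r) (hX : HasLaw X (expMeasure r) P) :
    ∀ᵐ ω ∂P, 0 < X ω := by
  have := isProbabilityMeasure_expMeasure hr
  have h : ∀ᵐ x ∂(P.map X), x ∈ Set.Ioi (0 : ℝ) := by
    rw [hX.map_eq]
    exact (mem_ae_iff_prob_eq_one measurableSet_Ioi).2 (by simp [expMeasure_Ioi hr le_rfl])
  exact ae_of_ae_map hX.aemeasurable h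

variable {Ω : Type*} [MeasurableSpace Ω] {P : Measure Ω} [IsProbabilityMeasure P] {X Y : Ω → ℝ}
  {a b : ℝ}

theorem lintegral_min_exponential (ha : 0 < a) (hb : 0 < b) (hX : HasLaw X (expMeasure a) P)
    (hY : HasLaw Y (expMeasure b) P) (hXY : IndepFun X Y P) {c : ℝ} (hc : 0 < c) :
    ∫⁻ ω, ENNReal.ofReal (min (X ω) (Y ω * c)) ∂P = ENNReal.ofReal (1 / (a + b / c)) := by
  have hm : AEMeasurable (fun ω => min (X ω) (Y ω * c)) P :=
    hX.aemeasurable.min (hY.aemeasurable.mul_const c)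
  have hr : 0 < a + b / c := by positivity
  rw [lintegral_eq_lintegral_meas_lt P _ hm]
  -- By independence the tails multiply: the minimum is exponential of rate `a + b / c`.
  · have htail : ∀ t ∈ Set.Ioi (0 : ℝ), P {ω | t < min (X ω) (Y ω * c)} =
        ENNReal.ofReal (Real.exp (-(a + b / c) * t)) := by
      intro t ht
      have hset : {ω | t < min (X ω) (Y ω * c)} = X ⁻¹' Set.Ioi t ∩ Y ⁻¹' Set.Ioi (t / c) := by
        ext ω
        simp [div_lt_iff₀ hc]
      have ht' : 0 ≤ t := le_of_lt ht
      rw [hset, hXY.measure_inter_preimage_eq_mul _ _ measurableSet_Ioi measurableSet_Ioi,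
        ← Measure.map_apply_of_aemeasurable hX.aemeasurable measurableSet_Ioi,
        ← Measure.map_apply_of_aemeasurable hY.aemeasurable measurableSet_Ioi, hX.map_eq,
        hY.map_eq, expMeasure_Ioi ha ht', expMeasure_Ioi hb (by positivity),
        ← ENNReal.ofReal_mul (Real.exp_nonneg _), ← Real.exp_add]
      congr 2
      ring
    rw [setLIntegral_congr_fun measurableSet_Ioi htail, ← ofReal_integral_eq_lintegral_ofReal]
    · rw [integral_exp_mul_Ioi (by linarith)]
      congr 1
      rw [mul_zero, Real.exp_zero, neg_div_neg_eq]
    · exact exp_neg_integrableOn_Ioi 0 hr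
    · exact Eventually.of_forall fun _ => Real.exp_nonneg _
  · filter_upwards [ae_pos_of_hasLaw_expMeasure ha hX, ae_pos_of_hasLaw_expMeasure hb hY]
      with ω h1 h2
    exact le_min h1.le (by positivity)

theorem ae_nonneg_min_exponential (ha : 0 < a) (hb : 0 < b) (hX : HasLaw X (expMeasure a) P)
    (hY : HasLaw Y (expMeasure b) P) {c : ℝ} (hc : 0 < c) :
    0 ≤ᵐ[P] fun ω => min (X ω) (Y ω * c) := by
  filter_upwards [ae_pos_of_hasLaw_expMeasure ha hX, ae_pos_of_hasLaw_expMeasure hb hY]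
    with ω h1 h2
  exact le_min h1.le (by positivity)

theorem integrable_min_exponential (ha : 0 < a) (hb : 0 < b) (hX : HasLaw X (expMeasure a) P)
    (hY : HasLaw Y (expMeasure b) P) (hXY : IndepFun X Y P) {c : ℝ} (hc : 0 < c) :
    Integrable (fun ω => min (X ω) (Y ω * c)) P := by
  refine ⟨(hX.aemeasurable.min (hY.aemeasurable.mul_const c)).aestronglyMeasurable, ?_⟩
  rw [hasFiniteIntegral_iff_ofReal (ae_nonneg_min_exponential ha hb hX hY hc),
    lintegral_min_exponential ha hb hX hY hXY hc]
  exact ENNReal.ofReal_lt_top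

theorem integral_min_exponential (ha : 0 < a) (hb : 0 < b) (hX : HasLaw X (expMeasure a) P)
    (hY : HasLaw Y (expMeasure b) P) (hXY : IndepFun X Y P) {c : ℝ} (hc : 0 < c) :
    ∫ ω, min (X ω) (Y ω * c) ∂P = 1 / (a + b / c) := by
  rw [integral_eq_lintegral_of_nonneg_ae (ae_nonneg_min_exponential ha hb hX hY hc)
    (integrable_min_exponential ha hb hX hY hXY hc).aestronglyMeasurable,
    lintegral_min_exponential ha hb hX hY hXY hc, ENNReal.toReal_ofReal (by positivity)]

end Exponential

/-! ### The fixed-point equation as a drift balance. -/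

section FixedPoint

variable {mu nu M L : ℝ}

theorem eq_mul_inv_iff_drift_balance (hmu : 0 < mu) (hnu : 0 < nu) (hM : 0 < M) {u : ℝ}
    (hu : 0 < u) : u = L * (1 / (mu + nu / max 1 (u / M))) ↔ mu * u + nu * min u M = L := by
  have h1 : nu / max 1 (u / M) * u = nu * min u M := by
    rcases le_total u M with h | h
    · rw [min_eq_left h, max_eq_left ((div_le_one hM).2 h), div_one]
    · rw [min_eq_right h, max_eq_right ((one_le_div hM).2 h)]
      field_simp
  have h2 : 0 < mu + nu / max 1 (u / M) := by positivity
  rw [mul_one_div, eq_div_iff h2.ne', mul_add, mul_comm u (nu / _), h1, mul_comm u mu]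

theorem exists_drift_balance (hmu : 0 < mu) (hnu : 0 < nu) (hM : 0 < M) (hL : 0 < L) :
    ∃ u, 0 < u ∧ mu * u + nu * min u M = L := by
  have hcont : ContinuousOn (fun u => mu * u + nu * min u M) (Set.Icc 0 (L / mu)) := by fun_prop
  have hsub := intermediate_value_Icc (by positivity) hcont
  obtain ⟨u, hu, hu'⟩ := hsub (show L ∈ _ by
    refine ⟨by simp [hM.le, hL.le], ?_⟩
    have : 0 ≤ nu * min (L / mu) M := by positivity
    have : mu * (L / mu) = L := by field_simp
    linarith)
  refine ⟨u, lt_of_le_of_ne hu.1 ?_, hu'⟩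
  rintro rfl
  simp [hM.le] at hu'
  exact hL.ne hu'

theorem drift_balance_injective (hmu : 0 < mu) (hnu : 0 < nu) {u v : ℝ}
    (h : mu * u + nu * min u M = mu * v + nu * min v M) : u = v := by
  have hmono : StrictMono fun u : ℝ => mu * u + nu * min u M := by
    intro x y hxy
    have h1 : mu * x < mu * y := mul_lt_mul_of_pos_left hxy hmu
    have h2 : nu * min x M ≤ nu * min y M :=
      mul_le_mul_of_nonneg_left (min_le_min_right _ hxy.le) hnu.le
    simp only
    linarith
  exact hmono.injective h

end FixedPoint

/-! ### The parking chain: stationarity and the action of its generator. -/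

namespace ParkingLot

variable {S : ParkingLot}

theorem State.uncharged_le_total (s : S.State) : s.uncharged ≤ s.total := s.2

theorem State.total_le_spaces (s : S.State) : s.total ≤ S.spaces := Nat.lt_succ_iff.1 s.1.2.2

theorem State.ext_counts {s t : S.State} (hu : s.uncharged = t.uncharged)
    (hq : s.total = t.total) : s = t :=
  Subtype.ext (Prod.ext (Fin.ext hu) (Fin.ext hq))

theorem State.exists_counts {u q : ℕ} (huq : u ≤ q) (hq : q ≤ S.spaces) :
    ∃ s : S.State, s.uncharged = u ∧ s.total = q :=
  ⟨⟨(⟨u, by omega⟩, ⟨q, by omega⟩), huq⟩, rfl, rfl⟩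

theorem rate_self (s : S.State) : S.rate s s = 0 := by
  simp [rate]

theorem rate_nonneg (ha : 0 ≤ S.arrivalRate) (hp : 0 ≤ S.parkingRate) (hc : 0 ≤ S.chargingRate)
    (hP : 0 ≤ S.power) (s t : S.State) : 0 ≤ S.rate s t := by
  have h : (s.uncharged : ℝ) ≤ s.total := by exact_mod_cast s.uncharged_le_total
  unfold rate
  split_ifs
  · exact ha
  · exact mul_nonneg hc (le_min (Nat.cast_nonneg _) hP)
  · positivity
  · exact mul_nonneg hp (sub_nonneg.2 h)
  · exact le_rfl

theorem generator_of_ne {s t : S.State} (h : s ≠ t) : S.generator s t = S.rate s t := by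
  simp [generator, h]

theorem generator_mulVec (f : S.State → ℝ) (s : S.State) :
    (S.generator *ᵥ f) s = ∑ t, S.rate s t * (f t - f s) := by
  have h : ∀ t, S.generator s t * f t =
      S.rate s t * f t + if s = t then -(∑ r, S.rate s r) * f s else 0 := by
    intro t
    by_cases hst : s = t
    · subst hst
      simp [generator, rate_self]
    · simp [generator, hst]
  simp only [Matrix.mulVec, dotProduct, h, Finset.sum_add_distrib, Finset.sum_ite_eq,
    Finset.mem_univ, if_true, mul_sub, Finset.sum_sub_distrib, ← Finset.sum_mul]
  ring

theorem sum_generator (s : S.State) : ∑ t, S.generator s t = 0 := by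
  have := generator_mulVec (fun _ => 1) s
  simpa [Matrix.mulVec, dotProduct] using this

theorem sum_mul_sum_rate_eq_zero {p : S.State → ℝ} (hp : p ᵥ* S.generator = 0)
    (f : S.State → ℝ) : ∑ s, p s * ∑ t, S.rate s t * (f t - f s) = 0 := by
  simp only [← generator_mulVec]
  change p ⬝ᵥ (S.generator *ᵥ f) = 0
  rw [Matrix.dotProduct_mulVec, hp, zero_dotProduct]

theorem isStationary_iff (π : Measure S.State) :
    S.IsStationary π ↔ IsProbabilityMeasure π ∧ (fun s => π.real {s}) ᵥ* S.generator = 0 := by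
  unfold IsStationary transition
  rw [vecMul_exp_eq_self_iff]

theorem exists_rate_pos_of_total_ne_zero (hp : 0 < S.parkingRate) {s : S.State}
    (hs : s.total ≠ 0) : ∃ t : S.State, t.total < s.total ∧ 0 < S.rate s t := by
  have h1 := s.uncharged_le_total
  have h2 := s.total_le_spaces
  rcases Nat.eq_zero_or_pos s.uncharged with h0 | h0
  · obtain ⟨t, htu, htq⟩ := State.exists_counts (S := S) (u := 0) (q := s.total - 1)
      (by omega) (by omega)
    refine ⟨t, by omega, ?_⟩
    have : (0 : ℝ) < s.total := by exact_mod_cast Nat.pos_of_ne_zero hs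
    rw [rate, if_neg (by omega), if_neg (by omega), if_neg (by omega), if_pos (by omega), h0]
    simpa using mul_pos hp this
  · obtain ⟨t, htu, htq⟩ := State.exists_counts (S := S) (u := s.uncharged - 1)
      (q := s.total - 1) (by omega) (by omega)
    refine ⟨t, by omega, ?_⟩
    have : (0 : ℝ) < s.uncharged := by exact_mod_cast h0
    rw [rate, if_neg (by omega), if_neg (by omega), if_pos (by omega)]
    exact mul_pos hp this

theorem existsUnique_isStationary (ha : 0 ≤ S.arrivalRate) (hp : 0 < S.parkingRate)
    (hc : 0 ≤ S.chargingRate) (hP : 0 ≤ S.power) : ∃! π : Measure S.State, S.IsStationary π := by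
  obtain ⟨s₀, hu₀, hq₀⟩ := State.exists_counts (S := S) (u := 0) (q := 0) le_rfl (Nat.zero_le _)
  obtain ⟨p, ⟨hp0, hp1, hpG⟩, huniq⟩ := existsUnique_stationary_vector (G := S.generator)
    (fun s t h => by rw [generator_of_ne h]; exact rate_nonneg ha hp.le hc hP s t)
    -- The rank is the number of EVs: departures alone empty the lot, so arrivals may even have rate
    -- zero, as when `n = 0`.
    sum_generator s₀ State.total (fun s hs => by
      obtain ⟨t, ht, hst⟩ := exists_rate_pos_of_total_ne_zero hp (s := s) fun h0 =>
        hs (State.ext_counts (by have := s.uncharged_le_total; omega) (by omega))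
      refine ⟨t, ht, ?_⟩
      rwa [generator_of_ne]
      rintro rfl
      exact ht.false)
  let w : PMF S.State := PMF.ofFintype (fun s => ENNReal.ofReal (p s)) (by
    rw [← ENNReal.ofReal_sum_of_nonneg fun s _ => hp0 s, hp1, ENNReal.ofReal_one])
  have hw : (fun s => w.toMeasure.real {s}) = p := by
    funext s
    rw [measureReal_def, PMF.toMeasure_apply_singleton _ _ (measurableSet_singleton s)]
    exact ENNReal.toReal_ofReal (hp0 s)
  refine ⟨w.toMeasure, (isStationary_iff _).2 ⟨inferInstance, by rw [hw, hpG]⟩, ?_⟩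
  intro π hπ
  obtain ⟨hprob, hπG⟩ := (isStationary_iff π).1 hπ
  have hπp := huniq (fun s => π.real {s}) ⟨fun s => measureReal_nonneg, by
    rw [sum_measureReal_singleton]; simp, hπG⟩
  refine Measure.ext_of_singleton fun s => ?_
  rw [← ENNReal.toReal_eq_toReal_iff' (measure_ne_top _ _) (measure_ne_top _ _)]
  exact congrFun (hπp.trans hw.symm) s

theorem sum_ite_mul_eq (c : S.State → Prop) [DecidablePred c] (A x : ℝ) (H : S.State → ℝ)
    (h : A = 0 ∨ ∃ t₀, (∀ t, c t ↔ t = t₀) ∧ H t₀ = x) :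
    ∑ t, (if c t then A else 0) * H t = A * x := by
  rcases h with rfl | ⟨t₀, ht₀, rfl⟩
  · simp
  · simp [ht₀]

theorem rate_eq_sum (s t : S.State) : S.rate s t =
    (if t.uncharged = s.uncharged + 1 ∧ t.total = s.total + 1 then
      (if s.total < S.spaces then S.arrivalRate else 0) else 0) +
    (if t.uncharged + 1 = s.uncharged ∧ t.total = s.total then
      S.chargingRate * S.powerUsed s.uncharged else 0) +
    (if t.uncharged + 1 = s.uncharged ∧ t.total + 1 = s.total then
      S.parkingRate * s.uncharged else 0) +
    (if t.uncharged = s.uncharged ∧ t.total + 1 = s.total then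
      S.parkingRate * ((s.total : ℝ) - s.uncharged) else 0) := by
  unfold rate
  have ht := t.total_le_spaces
  by_cases h1 : t.uncharged = s.uncharged + 1 ∧ t.total = s.total + 1
  · rw [if_pos h1, if_pos h1, if_pos (by omega), if_neg (by omega), if_neg (by omega),
      if_neg (by omega)]
    ring
  rw [if_neg h1, if_neg h1]
  by_cases h2 : t.uncharged + 1 = s.uncharged ∧ t.total = s.total
  · rw [if_pos h2, if_pos h2, if_neg (by omega), if_neg (by omega)]
    ring
  rw [if_neg h2, if_neg h2]
  by_cases h3 : t.uncharged + 1 = s.uncharged ∧ t.total + 1 = s.total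
  · rw [if_pos h3, if_pos h3, if_neg (by omega)]
    ring
  rw [if_neg h3, if_neg h3]
  ring

/-- A target state is missing only where the corresponding rate vanishes: full lot, `u = 0`, or `u =
q`. The subtractions inside `h` are real, so the formula needs no boundary cases. -/
theorem sum_rate_mul (hP : 0 ≤ S.power) (s : S.State) (h : ℝ → ℝ → ℝ) :
    ∑ t, S.rate s t * h t.uncharged t.total =
      (if s.total < S.spaces then S.arrivalRate else 0) * h (s.uncharged + 1) (s.total + 1) +
      S.chargingRate * S.powerUsed s.uncharged * h (s.uncharged - 1) s.total +
      S.parkingRate * s.uncharged * h (s.uncharged - 1) (s.total - 1) +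
      S.parkingRate * ((s.total : ℝ) - s.uncharged) * h s.uncharged (s.total - 1) := by
  have hs1 := s.uncharged_le_total
  have hs2 := s.total_le_spaces
  simp only [rate_eq_sum, add_mul, Finset.sum_add_distrib]
  congr 1
  congr 1
  congr 1
  · refine sum_ite_mul_eq _ _ _ _ ?_
    by_cases hq : s.total < S.spaces
    · obtain ⟨t, htu, htq⟩ := State.exists_counts (S := S) (u := s.uncharged + 1)
        (q := s.total + 1) (by omega) (by omega)
      refine Or.inr ⟨t, fun t' => ⟨fun h' => State.ext_counts (by omega) (by omega), ?_⟩, ?_⟩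
      · rintro rfl
        exact ⟨htu, htq⟩
      · simp [htu, htq]
    · exact Or.inl (if_neg hq)
  · refine sum_ite_mul_eq _ _ _ _ ?_
    rcases Nat.eq_zero_or_pos s.uncharged with hu | hu
    · exact Or.inl (by simp [hu, powerUsed, hP])
    · obtain ⟨t, htu, htq⟩ := State.exists_counts (S := S) (u := s.uncharged - 1)
        (q := s.total) (by omega) (by omega)
      refine Or.inr ⟨t, fun t' => ⟨fun h' => State.ext_counts (by omega) (by omega), ?_⟩, ?_⟩
      · rintro rfl
        omega
      · simp [htu, htq, Nat.cast_sub hu]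
  · refine sum_ite_mul_eq _ _ _ _ ?_
    rcases Nat.eq_zero_or_pos s.uncharged with hu | hu
    · exact Or.inl (by simp [hu])
    · obtain ⟨t, htu, htq⟩ := State.exists_counts (S := S) (u := s.uncharged - 1)
        (q := s.total - 1) (by omega) (by omega)
      refine Or.inr ⟨t, fun t' => ⟨fun h' => State.ext_counts (by omega) (by omega), ?_⟩, ?_⟩
      · rintro rfl
        omega
      · simp [htu, htq, Nat.cast_sub hu, Nat.cast_sub (hu.trans_le hs1)]
  · refine sum_ite_mul_eq _ _ _ _ ?_
    rcases hs1.eq_or_lt with hu | hu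
    · exact Or.inl (by simp [hu])
    · obtain ⟨t, htu, htq⟩ := State.exists_counts (S := S) (u := s.uncharged)
        (q := s.total - 1) (by omega) (by omega)
      refine Or.inr ⟨t, fun t' => ⟨fun h' => State.ext_counts (by omega) (by omega), ?_⟩, ?_⟩
      · rintro rfl
        omega
      · simp [htu, htq, Nat.cast_sub (Nat.one_le_of_lt hu)]

end ParkingLot

/-! ### Quadratic drift estimates. -/

section Drift

variable {lam mu nu M K N : ℝ}

theorem drift_sq_total_le (hlam : 0 < lam) (hmu : 0 < mu) (hK : 0 < K) (hN : 0 < N)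
    {a q k : ℝ} (hqk : q ≤ k) (hkN : k ≤ N * K) (hNk : N * K ≤ k + 1)
    (ha : a = N * lam ∧ q < k ∨ a = 0 ∧ q = k) :
    a * (2 * (q - N * min (lam / mu) K) + 1) + mu * q * (-2 * (q - N * min (lam / mu) K) + 1) ≤
      -2 * mu * (q - N * min (lam / mu) K) ^ 2 + (lam + 3 * mu * K) * N := by
  set b := min (lam / mu) K with hb
  have hb0 : 0 < b := lt_min (by positivity) hK
  have hbK : b ≤ K := min_le_right _ _
  have hq : mu * q ≤ mu * (N * K) := mul_le_mul_of_nonneg_left (hqk.trans hkN) hmu.le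
  have hbN : N * b ≤ N * K := mul_le_mul_of_nonneg_left hbK hN.le
  have h0 : 0 ≤ mu * N * K := by positivity
  have h1 : 0 ≤ lam * N := by positivity
  rcases ha with ⟨rfl, hlt⟩ | ⟨rfl, rfl⟩
  -- Either `μ b = λ` and the second factor is zero, or `b = K`, where the factors have opposite
  -- signs.
  · have key : (q - N * b) * (N * lam - mu * (N * b)) ≤ 0 := by
      rcases le_total (lam / mu) K with h | h
      · rw [hb, min_eq_left h]
        have : mu * (N * (lam / mu)) = N * lam := by field_simp
        rw [this]
        simp
      · rw [hb, min_eq_right h]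
        rw [le_div_iff₀ hmu] at h
        refine mul_nonpos_of_nonpos_of_nonneg (by linarith) ?_
        have := mul_le_mul_of_nonneg_left h hN.le
        linarith
    linarith
  -- In a full lot, rounding the number of spaces down puts `q` at most one below `N b`; this costs
  -- only `O(N)`.
  · have key : 0 ≤ (q - N * b + 1) * (mu * (N * b)) :=
      mul_nonneg (by linarith) (by positivity)
    have := mul_le_mul_of_nonneg_left hbN hmu.le
    linarith

/-- `min · m` is monotone and 1-Lipschitz: the shift by `-y` has the favourable sign when multiplied
by `y`, so only the shift by `x` costs anything. -/
theorem mul_min_sub_min_le (x y b m : ℝ) :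
    y * (min (x - y + b) m - min b m) ≤ |x| * |y| := by
  have hx := neg_abs_le x
  have hx' := le_abs_self x
  rcases le_total 0 y with hy | hy
  · rw [abs_of_nonneg hy, mul_comm]
    refine mul_le_mul_of_nonneg_right ?_ hy
    have := abs_nonneg x
    rcases min_cases (x - y + b) m with h | h <;> rcases min_cases b m with h' | h' <;> linarith
  · rw [abs_of_nonpos hy]
    have : -|x| ≤ min (x - y + b) m - min b m := by
      have := abs_nonneg x
      rcases min_cases (x - y + b) m with h | h <;> rcases min_cases b m with h' | h' <;> linarith
    nlinarith

/-- Departures of uncharged EVs leave `q - u` unchanged, so only charge completions and departures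
of charged EVs enter. The cross term `2 ν |x| |y|` is split by Young's inequality, spending half of
the `-2 μ y²` available. -/
theorem drift_sq_charged_le (hmu : 0 < mu) (hnu : 0 < nu)
    {u q b v : ℝ} (hu : 0 ≤ u) (hqN : q ≤ N * K)
    (hv : mu * v + nu * min v M = mu * b) (hN : 0 < N) :
    nu * min u (N * M) * (2 * (q - u - N * (b - v)) + 1) +
        mu * (q - u) * (-2 * (q - u - N * (b - v)) + 1) ≤
      -mu * (q - u - N * (b - v)) ^ 2 + nu ^ 2 / mu * (q - N * b) ^ 2 + (nu * M + mu * K) * N := by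
  set x := q - N * b with hx
  set y := q - u - N * (b - v) with hy
  have hbal : nu * min (N * v) (N * M) = mu * (N * (b - v)) := by
    rw [← mul_min_of_nonneg _ _ hN.le]
    linear_combination N * hv
  have h1 := mul_le_mul_of_nonneg_left (mul_min_sub_min_le x y (N * v) (N * M)) hnu.le
  have hxy : x - y + N * v = u := by rw [hx, hy]; ring
  rw [hxy] at h1
  have h2 : 2 * (nu * (|x| * |y|)) ≤ nu ^ 2 / mu * x ^ 2 + mu * y ^ 2 := by
    rw [← sq_abs x, ← sq_abs y]
    have h3 : nu ^ 2 / mu * |x| ^ 2 + mu * |y| ^ 2 - 2 * (nu * (|x| * |y|)) =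
        (nu * |x| - mu * |y|) ^ 2 / mu := by
      field_simp
      ring
    have : 0 ≤ (nu * |x| - mu * |y|) ^ 2 / mu := by positivity
    linarith
  have h4 : nu * min u (N * M) ≤ nu * (N * M) :=
    mul_le_mul_of_nonneg_left (min_le_right _ _) hnu.le
  have h5 : mu * (q - u) ≤ mu * (N * K) := mul_le_mul_of_nonneg_left (by linarith) hmu.le
  have h6 : q - u = y + N * (b - v) := by rw [hy]; ring
  have h7 : y * (nu * min (N * v) (N * M)) = y * (mu * (N * (b - v))) := by rw [hbal]
  have h8 : mu * (q - u) * (-2 * y + 1) =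
      -2 * mu * y ^ 2 - 2 * (y * (mu * (N * (b - v)))) + mu * (q - u) := by
    linear_combination (-2 * mu * y) * h6
  rw [h8]
  linarith

end Drift

/-! ### Second moment bound, Chebyshev's inequality and the conclusion. -/

namespace ParkingLot

variable {lam mu nu M K : ℝ}

theorem exists_second_moment_bound (hlam : 0 < lam) (hmu : 0 < mu) (hnu : 0 < nu) (hM : 0 < M)
    (hK : 0 < K) {v : ℝ} (hv : mu * v + nu * min v M = min lam (mu * K)) :
    ∃ C : ℝ, ∀ n : ℕ, 0 < n → ∀ π : Measure (scaled lam mu nu M K n).State,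
      (scaled lam mu nu M K n).IsStationary π →
      ∑ s, π.real {s} * ((s.uncharged : ℝ) - n * v) ^ 2 ≤ C * n := by
  set b := min (lam / mu) K with hb
  have hmub : mu * b = min lam (mu * K) := by
    rw [hb, mul_min_of_nonneg _ _ hmu.le, mul_div_cancel₀ _ hmu.ne']
  -- This weight absorbs the error `(ν²/μ) x²` and leaves `-μ x² - μ y²`, which is at most `-(μ/2)(x
  -- - y)²`.
  set β := (nu ^ 2 / mu + mu) / (2 * mu) with hβ
  have hβ0 : 0 < β := by positivity
  have hβmu : β * (2 * mu) = nu ^ 2 / mu + mu := by rw [hβ]; field_simp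
  set C := β * (lam + 3 * mu * K) + (nu * M + mu * K) with hC
  refine ⟨2 / mu * C, fun n hn π hπ => ?_⟩
  obtain ⟨hprob, hπG⟩ := (isStationary_iff π).1 hπ
  have hN : (0 : ℝ) < n := by exact_mod_cast hn
  let h : ℝ → ℝ → ℝ := fun u q => β * (q - n * b) ^ 2 + (q - u - n * (b - v)) ^ 2
  have hdrift : ∀ s : (scaled lam mu nu M K n).State,
      ∑ t, (scaled lam mu nu M K n).rate s t *
        (h t.uncharged t.total - h s.uncharged s.total) ≤
      -(mu / 2) * ((s.uncharged : ℝ) - n * v) ^ 2 + C * n := by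
    intro s
    rw [sum_rate_mul (by simp only [scaled]; positivity) s
      (fun u q => h u q - h s.uncharged s.total)]
    have hsK : ((scaled lam mu nu M K n).spaces : ℝ) ≤ n * K := Nat.floor_le (by positivity)
    have hsK' : (n : ℝ) * K ≤ (scaled lam mu nu M K n).spaces + 1 := (Nat.lt_floor_add_one _).le
    have hq : (s.total : ℝ) ≤ (scaled lam mu nu M K n).spaces := by
      exact_mod_cast s.total_le_spaces
    have h1 := drift_sq_total_le hlam hmu hK hN (a := if s.total < (scaled lam mu nu M K n).spaces
      then (scaled lam mu nu M K n).arrivalRate else 0) hq hsK hsK' (by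
        by_cases hlt : s.total < (scaled lam mu nu M K n).spaces
        · exact Or.inl ⟨if_pos hlt, by exact_mod_cast hlt⟩
        · exact Or.inr ⟨if_neg hlt, by exact_mod_cast s.total_le_spaces.antisymm (not_lt.1 hlt)⟩)
    have h2 := drift_sq_charged_le hmu hnu (M := M) (K := K) (Nat.cast_nonneg s.uncharged)
      (hq.trans hsK) (hv.trans hmub.symm) hN
    rw [← hb] at h1
    generalize (if s.total < (scaled lam mu nu M K n).spaces
      then (scaled lam mu nu M K n).arrivalRate else 0) = a at h1 ⊢
    have h3 := mul_le_mul_of_nonneg_left h1 hβ0.le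
    have hpow : (scaled lam mu nu M K n).powerUsed s.uncharged =
      min (s.uncharged : ℝ) (n * M) := rfl
    rw [hpow]
    change _ + nu * _ * _ + mu * _ * _ + mu * _ * _ ≤ _
    generalize (s.uncharged : ℝ) = u at *
    generalize (s.total : ℝ) = q at *
    simp only [h]
    have h4 : 0 ≤ mu / 2 * ((q - n * b) + (q - u - n * (b - v))) ^ 2 := by positivity
    have h5 : β * (2 * mu) * (q - n * b) ^ 2 = (nu ^ 2 / mu + mu) * (q - n * b) ^ 2 := by
      rw [hβmu]
    rw [hC]
    linarith
  -- Averaging the drift bound against `π` makes its left side zero, which isolates the second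
  -- moment.
  have hzero := sum_mul_sum_rate_eq_zero hπG (fun s => h s.uncharged s.total)
  have hle := Finset.sum_le_sum fun s (_ : s ∈ Finset.univ) =>
    mul_le_mul_of_nonneg_left (hdrift s) (measureReal_nonneg (μ := π) (s := {s}))
  rw [hzero] at hle
  have hmass : ∑ s, π.real {s} = 1 := by
    rw [sum_measureReal_singleton]
    simp
  have hsplit : ∑ s, π.real {s} * (-(mu / 2) * ((s.uncharged : ℝ) - n * v) ^ 2 + C * n) =
      -(mu / 2) * ∑ s, π.real {s} * ((s.uncharged : ℝ) - n * v) ^ 2 + C * n := by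
    simp only [mul_add, Finset.sum_add_distrib, ← Finset.sum_mul, hmass, one_mul, Finset.mul_sum]
    congr 1
    exact Finset.sum_congr rfl fun s _ => by ring
  rw [hsplit] at hle
  rw [div_mul_eq_mul_div, div_mul_eq_mul_div, le_div_iff₀ hmu]
  linarith

theorem measureReal_uncharged_le {S : ParkingLot} (π : Measure S.State) [IsProbabilityMeasure π]
    {N v ε C : ℝ} (hN : 0 < N) (hε : 0 < ε)
    (h : ∑ s, π.real {s} * ((s.uncharged : ℝ) - N * v) ^ 2 ≤ C * N) :
    π.real {s | ε ≤ |(s.uncharged : ℝ) / N - v|} ≤ C / ε ^ 2 / N := by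
  classical
  set A : Finset S.State := Finset.univ.filter fun s => ε ≤ |(s.uncharged : ℝ) / N - v| with hA
  have hAset : {s : S.State | ε ≤ |(s.uncharged : ℝ) / N - v|} = A := by
    ext s
    simp [hA]
  have hmem : ∀ s ∈ A, (ε * N) ^ 2 ≤ ((s.uncharged : ℝ) - N * v) ^ 2 := by
    intro s hs
    have h1 : ε ≤ |(s.uncharged : ℝ) / N - v| := (Finset.mem_filter.1 hs).2
    have h2 : |(s.uncharged : ℝ) - N * v| = |(s.uncharged : ℝ) / N - v| * N := by
      rw [← abs_of_pos hN, ← abs_mul, abs_of_pos hN]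
      congr 1
      field_simp
    rw [← sq_abs ((s.uncharged : ℝ) - N * v), h2]
    gcongr
  have h3 : π.real A * (ε * N) ^ 2 ≤ C * N := by
    rw [← sum_measureReal_singleton, Finset.sum_mul]
    calc _ ≤ ∑ s ∈ A, π.real {s} * ((s.uncharged : ℝ) - N * v) ^ 2 :=
          Finset.sum_le_sum fun s hs => mul_le_mul_of_nonneg_left (hmem s hs) measureReal_nonneg
      _ ≤ ∑ s, π.real {s} * ((s.uncharged : ℝ) - N * v) ^ 2 :=
          Finset.sum_le_sum_of_subset_of_nonneg (Finset.subset_univ _) fun s _ _ =>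
            mul_nonneg measureReal_nonneg (sq_nonneg _)
      _ ≤ C * N := h
  rw [hAset, div_div, le_div_iff₀ (by positivity)]
  have h4 : π.real A * (ε ^ 2 * N) * N ≤ C * N := by linarith
  exact le_of_mul_le_mul_right h4 hN

end ParkingLot

theorem mainTheorem2
    (lam mu nu M K : ℝ) (hlam : 0 < lam) (hmu : 0 < mu) (hnu : 0 < nu) (hM : 0 < M) (hMK : M ≤ K)
    {Ω : Type*} [MeasurableSpace Ω] (P : Measure Ω) [IsProbabilityMeasure P]
    (Emu Enu : Ω → ℝ) (hEmu : HasLaw Emu (expMeasure mu) P) (hEnu : HasLaw Enu (expMeasure nu) P)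
    (hindep : IndepFun Emu Enu P) :
    (∀ n : ℕ, ∃! π : Measure (ParkingLot.scaled lam mu nu M K n).State,
      (ParkingLot.scaled lam mu nu M K n).IsStationary π) ∧
    (∀ u : ℝ, 0 < u → Integrable (fun ω => min (Emu ω) (Enu ω * max 1 (u / M))) P) ∧
    ∃ u : ℝ, 0 < u ∧
      u = min lam (mu * K) * ∫ ω, min (Emu ω) (Enu ω * max 1 (u / M)) ∂P ∧
      (∀ v : ℝ, 0 < v →
        v = min lam (mu * K) * ∫ ω, min (Emu ω) (Enu ω * max 1 (v / M)) ∂P → v = u) ∧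
      ∀ (Ω' : ℕ → Type*) [∀ n, MeasurableSpace (Ω' n)] (P' : ∀ n, Measure (Ω' n))
        (X : ∀ n, Ω' n → (ParkingLot.scaled lam mu nu M K n).State),
        (∀ n, Measurable (X n)) →
        (∀ n, (ParkingLot.scaled lam mu nu M K n).IsStationary ((P' n).map (X n))) →
        ∀ ε : ℝ, 0 < ε →
          Tendsto (fun n => P' n {ω | ε ≤ |((X n ω).uncharged : ℝ) / n - u|}) atTop (𝓝 0) := by
  have hK : 0 < K := hM.trans_le hMK
  have hmax : ∀ u : ℝ, 0 < max 1 (u / M) := fun u => zero_lt_one.trans_le (le_max_left _ _)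
  have hfix : ∀ u : ℝ, 0 < u →
      (u = min lam (mu * K) * ∫ ω, min (Emu ω) (Enu ω * max 1 (u / M)) ∂P ↔
        mu * u + nu * min u M = min lam (mu * K)) := by
    intro u hu
    rw [integral_min_exponential hmu hnu hEmu hEnu hindep (hmax u)]
    exact eq_mul_inv_iff_drift_balance hmu hnu hM hu
  refine ⟨fun n => ?_, fun u _ =>
    integrable_min_exponential hmu hnu hEmu hEnu hindep (hmax u), ?_⟩
  · exact ParkingLot.existsUnique_isStationary (by simp only [ParkingLot.scaled]; positivity)
      hmu hnu.le (by simp only [ParkingLot.scaled]; positivity)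
  obtain ⟨u, hu, hbal⟩ := exists_drift_balance hmu hnu hM
    (L := min lam (mu * K)) (lt_min hlam (by positivity))
  refine ⟨u, hu, (hfix u hu).2 hbal, fun v hv hv' =>
    drift_balance_injective hmu hnu (((hfix v hv).1 hv').trans hbal.symm), ?_⟩
  intro Ω' _ P' X hX hstat ε hε
  obtain ⟨C, hC⟩ := ParkingLot.exists_second_moment_bound hlam hmu hnu hM hK hbal
  have hlim : Tendsto (fun n : ℕ => ENNReal.ofReal (C / ε ^ 2 / n)) atTop (𝓝 0) := by
    simpa [Function.comp_def] using (ENNReal.continuous_ofReal.tendsto 0).comp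
      (tendsto_const_div_atTop_nhds_zero_nat (C / ε ^ 2))
  refine tendsto_of_tendsto_of_tendsto_of_le_of_le' tendsto_const_nhds hlim
    (Eventually.of_forall fun _ => zero_le) ?_
  filter_upwards [eventually_gt_atTop 0] with n hn
  have := (hstat n).1
  have hset : {ω | ε ≤ |((X n ω).uncharged : ℝ) / n - u|} =
      X n ⁻¹' {s | ε ≤ |(s.uncharged : ℝ) / n - u|} := rfl
  rw [hset, ← Measure.map_apply (hX n) (Set.toFinite _).measurableSet, ← ofReal_measureReal]
  exact ENNReal.ofReal_le_ofReal (ParkingLot.measureReal_uncharged_le _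
    (by exact_mod_cast hn) hε (hC n hn _ (hstat n)))
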